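/- Let $V$ be a finite set of points in $\mathbb{R}^3$. A pair $\{p,q\}$ of distinct points of $V$ is a strict double-normal pair of $V$ if $V$ lies in the closed strip bounded by the planes $H_p$ and $H_q$ through $p$ and $q$ that are perpendicular to $pq$, and no point of $V\setminus\{p,q\}$ lies on $H_p$ or $H_q$. Let $N'(V)$ be the number of strict double-normal pairs of $V$. Fix a $2$-sphere in $\mathbb{R}^3$ with centre $c$ and radius $r>0$. (1) If $V$ is a finite set of at least $4$ points on the sphere, then $N'(V)\le 2|V|-2$. (2) The bound is sharp for each cardinality: for every $n\ge 4$ there is a set $V$ of $n$ points on the sphere with $N'(V)=2n-2$. (3) For $n=5$ an example is the following. Let $p_1,p_2,p_3$ be three equidistant points on a great circle $C_1$ of the sphere, and let $p_4,p_5$ be points different from $p_3$ on the great circle $C_2$ through $p_3$ perpendicular to $C_1$, sufficiently close to $p_3$ and with $p_3$ between $p_4$ and $p_5$. Then $p_1,\dots,p_5$ are distinct and $V=\{p_1,\dots,p_5\}$ has exactly $8$ strict double-normal pairs, namely all pairs except $\{p_3,p_4\}$ and $\{p_3,p_5\}$. -/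

import Mathlib

section DoubleNormal

variable {E : Type*} [NormedAddCommGroup E] [InnerProductSpace ℝ E]

/-- The hyperplane `H_p` through `p` perpendicular to the segment `pq` (for `p ≠ q`). -/
def normalHyperplane (p q : E) : Set E :=
  {z | inner ℝ (z - p) (q - p) = 0}

/-- The closed strip bounded by the hyperplanes through `p` and through `q` perpendicular to
the segment `pq`. -/
def closedStrip (p q : E) : Set E :=
  {z | 0 ≤ inner ℝ (z - p) (q - p) ∧ 0 ≤ inner ℝ (z - q) (p - q)}

/-- `{p, q}` is a double-normal pair of `V`. -/
def IsDoubleNormalPair (V : Set E) (p q : E) : Prop :=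
  p ∈ V ∧ q ∈ V ∧ p ≠ q ∧ V ⊆ closedStrip p q

/-- `{p, q}` is a strict double-normal pair of `V`: a double-normal pair such that no point of
`V` other than `p` and `q` lies on one of the two hyperplanes. -/
def IsStrictDoubleNormalPair (V : Set E) (p q : E) : Prop :=
  IsDoubleNormalPair V p q ∧
    Disjoint (V \ {p, q}) (normalHyperplane p q ∪ normalHyperplane q p)

theorem IsStrictDoubleNormalPair.swap {V : Set E} {p q : E}
    (h : IsStrictDoubleNormalPair V p q) : IsStrictDoubleNormalPair V q p := by
  obtain ⟨⟨hp, hq, hne, hV⟩, hd⟩ := h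
  refine ⟨⟨hq, hp, hne.symm, fun z hz => ⟨(hV hz).2, (hV hz).1⟩⟩, ?_⟩
  rwa [Set.pair_comm q p, Set.union_comm]

/-- The strict double-normal graph of `V`, with vertex set `V`. -/
def strictDoubleNormalGraph (V : Set E) : SimpleGraph V where
  Adj p q := IsStrictDoubleNormalPair V (p : E) (q : E)
  symm := ⟨fun _ _ h => h.swap⟩
  loopless := ⟨fun _ h => h.1.2.2.1 rfl⟩

/-- The number of strict double-normal pairs of a finite set `V`: the number of edges of its
strict double-normal graph. -/
noncomputable def strictDoubleNormalCount (V : Set E) : ℕ :=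
  (strictDoubleNormalGraph V).edgeSet.ncard

/-- Five points `p₁, …, p₅` (indexed by `0, …, 4`) on the sphere with centre `c` and radius `r`,
for orthonormal `u, v, w`: the points `p₁, p₂, p₃` are equidistant on the great circle `C₁`
in the directions spanned by `u, v`, with `p₃` in direction `u`; the points `p₄, p₅` lie on the
great circle through `p₃` perpendicular to `C₁`, on different sides of `p₃`, at angular
distances `s` and `t` from it. -/
noncomputable def fivePoints (c : E) (r : ℝ) (u v w : E) (s t : ℝ) : Fin 5 → E :=
  ![c + r • (Real.cos (2 * Real.pi / 3) • u + Real.sin (2 * Real.pi / 3) • v),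
    c + r • (Real.cos (2 * Real.pi / 3) • u - Real.sin (2 * Real.pi / 3) • v),
    c + r • u,
    c + r • (Real.cos s • u + Real.sin s • w),
    c + r • (Real.cos t • u - Real.sin t • w)]

end DoubleNormal

/-! Upper bound. Move the centre to the origin and put W = V ∪ -V. For points of a sphere the strip
of {p, q} is symmetric about the centre, so {p, q} is strict exactly when the functional ⟪p - q, ·⟫
attains its maximum over W only at p and -q; this holds as stated if V has no antipodal points.
Ordered strict pairs are then exposed edges between the disjoint halves V and -V of a set of 2|V|
points. A planar bipartite graph on 2|V| vertices has at most 4|V| - 4 edges, and halving gives 2|V|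
- 2.

The planar bound is obtained without Euler's formula. Each edge lies in two facets, and a facet with
k ≥ 3 points contains at most 2(k - 2) edges of the bipartite graph. For a generic direction u, all
but two points of a facet are neither highest nor lowest in it. A point of W has this role in at
most two facets, and the top and bottom of W in none. Double counting gives |E| ≤ 2(|W| - 2). Both
local bounds (edges at a vertex within a facet, facets around a vertex) rest on
`false_of_inner_neg_of_inner_eq_zero`.

Antipodal points are removed beforehand: by Thales, a point whose antipode is in V can be paired
strictly only with that antipode.

Sharpness and the example. On a sphere strictness depends only on the Gram matrix, so both reduce to
inequalities between cosines. For sharpness, two nearly antipodal poles are joined to each other and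
to all m points of a short arc, and the two ends of the arc are joined: 2m + 2 pairs on m + 2
points. -/

open Finset Module

local notation "E3" => EuclideanSpace ℝ (Fin 3)

/-! ### Linear algebra: sign patterns, normals and generic directions -/

/-- In a plane, three vectors `d i` and three functionals `f i` cannot satisfy `f i (d i) = 0` and
`f i (d j) < 0` for `i ≠ j`. -/
theorem false_of_inner_neg_of_inner_eq_zero {u : E3} (hu : u ≠ 0) {d f : Fin 3 → E3}
    (hd : ∀ i, inner ℝ u (d i) = 0) (hf : ∀ i, inner ℝ (f i) (d i) = 0)
    (hneg : ∀ i j, i ≠ j → inner ℝ (f i) (d j) < 0) : False := by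
  have hdep : ¬ LinearIndependent ℝ d := by
    intro h
    have hspan := h.span_eq_top_of_card_eq_finrank (by simp)
    have hmem : u ∈ (Submodule.span ℝ (Set.range d))ᗮ := by
      rw [Submodule.mem_orthogonal']
      intro x hx
      induction hx using Submodule.span_induction with
      | mem x hx => obtain ⟨i, rfl⟩ := hx; exact hd i
      | zero => simp
      | add x y _ _ hx hy => simp [inner_add_right, hx, hy]
      | smul a x _ hx => simp [inner_smul_right, hx]
    rw [hspan, Submodule.top_orthogonal_eq_bot] at hmem
    exact hu (by simpa using hmem)
  obtain ⟨g, hg, k, hk⟩ := Fintype.not_linearIndependent_iff.1 hdep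
  -- Applying `f i` to a linear dependence kills its `i`-th term. The other two coefficients then
  -- have opposite signs or both vanish, and three reals cannot be pairwise of opposite sign.
  have key : ∀ i, ∑ j, g j * inner ℝ (f i) (d j) = 0 := fun i => by
    have := congrArg (inner ℝ (f i)) hg
    simpa [inner_sum, inner_smul_right] using this
  have sgn : ∀ x y a b : ℝ, a < 0 → b < 0 → x * a + y * b = 0 →
      (0 < x → y < 0) ∧ (x < 0 → 0 < y) ∧ (x = 0 → y = 0) := by
    intro x y a b ha hb h
    refine ⟨fun hx => ?_, fun hx => ?_, fun hx => ?_⟩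
    · nlinarith
    · nlinarith
    · subst hx
      simpa [hb.ne] using h
  have h0 := key 0
  have h1 := key 1
  have h2 := key 2
  simp only [Fin.sum_univ_three, hf, mul_zero, zero_add, add_zero] at h0 h1 h2
  have s0 := sgn _ _ _ _ (hneg 0 1 (by decide)) (hneg 0 2 (by decide)) h0
  have s1 := sgn _ _ _ _ (hneg 1 0 (by decide)) (hneg 1 2 (by decide)) h1
  have s2 := sgn _ _ _ _ (hneg 2 0 (by decide)) (hneg 2 1 (by decide)) h2
  rcases lt_trichotomy (g 0) 0 with h | h | h
  · linarith [s1.2.1 h, s0.1 (s2.2.1 h)]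
  · fin_cases k
    · exact hk h
    · exact hk (s2.2.2 h)
    · exact hk (s1.2.2 h)
  · linarith [s1.1 h, s2.1 h, s0.2.1 (s2.1 h)]

/-- Unit normals of a plane through three distinct points of a sphere agree up to sign. -/
theorem eq_or_eq_neg_of_inner_const {r : ℝ} {x y z : E3} (hx : ‖x‖ = r) (hy : ‖y‖ = r)
    (hz : ‖z‖ = r) (hxy : x ≠ y) (hxz : x ≠ z) (hyz : y ≠ z) {ν ν' : E3} (hν : ‖ν‖ = 1)
    (hν' : ‖ν'‖ = 1) (h₁ : inner ℝ ν y = inner ℝ ν x) (h₂ : inner ℝ ν z = inner ℝ ν x)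
    (h₁' : inner ℝ ν' y = inner ℝ ν' x) (h₂' : inner ℝ ν' z = inner ℝ ν' x) :
    ν' = ν ∨ ν' = -ν := by
  have hc : EuclideanGeometry.Cospherical ({x, y, z} : Set E3) := ⟨0, r, by simp [hx, hy, hz]⟩
  have hai := hc.affineIndependent_of_ne hxy hxz hyz
  have hrank := hai.finrank_vectorSpan (n := 2) (by simp)
  -- No three points of a sphere are collinear, so the three points span a plane, whose normals form
  -- a line.
  have hort := (vectorSpan ℝ (Set.range ![x, y, z])).finrank_add_finrank_orthogonal
  rw [hrank, finrank_euclideanSpace_fin] at hort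
  have hmem : ∀ μ : E3, inner ℝ μ y = inner ℝ μ x → inner ℝ μ z = inner ℝ μ x →
      μ ∈ (vectorSpan ℝ (Set.range ![x, y, z]))ᗮ := by
    intro μ hy hz
    rw [vectorSpan_range_eq_span_range_vsub_right ℝ _ 0, Submodule.mem_orthogonal']
    intro w hw
    induction hw using Submodule.span_induction with
    | mem w hw =>
      obtain ⟨i, rfl⟩ := hw
      fin_cases i <;> simp [inner_sub_right, hy, hz]
    | zero => simp
    | add x y _ _ hx hy => simp [inner_add_right, hx, hy]
    | smul a x _ hx => simp [inner_smul_right, hx]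
  have hν0 : (⟨ν, hmem ν h₁ h₂⟩ : ((vectorSpan ℝ (Set.range ![x, y, z]))ᗮ : Submodule ℝ E3)) ≠ 0 := by
    intro h
    have : ν = 0 := congrArg Subtype.val h
    simp [this] at hν
  obtain ⟨a, ha⟩ := (finrank_eq_one_iff_of_nonzero' _ hν0).1 (Nat.add_left_cancel hort)
    ⟨ν', hmem ν' h₁' h₂'⟩
  have ha' : a • ν = ν' := congrArg Subtype.val ha
  have habs : |a| = 1 := by
    have := congrArg norm ha'
    simpa [norm_smul, hν, hν'] using this
  rcases (abs_eq zero_le_one).1 habs with rfl | rfl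
  · left; simpa using ha'.symm
  · right; simpa using ha'.symm

/-- Finitely many nonzero functionals `⟪x - y, ·⟫` have a common vector at which none of them
vanishes. -/
theorem exists_inner_injOn (W : Finset E3) : ∃ u : E3, Set.InjOn (fun x => inner ℝ u x) (W : Set E3) := by
  obtain ⟨u, hu⟩ := Module.Dual.exists_forall_ne_zero_of_forall_exists (K := ℝ) (M := E3)
    (fun p : {p : W × W // p.1 ≠ p.2} => (innerₛₗ ℝ ((p.1.1 : E3) - p.1.2) : E3 →ₗ[ℝ] ℝ))
    (fun p => ⟨(p.1.1 : E3) - p.1.2, by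
      have := p.2
      rw [innerₛₗ_apply_apply]
      exact inner_self_ne_zero.2 (sub_ne_zero.2 fun h => this (Subtype.ext h))⟩)
  refine ⟨u, fun x hx y hy hxy => ?_⟩
  by_contra hne
  refine hu ⟨(⟨x, hx⟩, ⟨y, hy⟩), by simpa using hne⟩ ?_
  simp only [innerₛₗ_apply_apply, inner_sub_left]
  rw [real_inner_comm, real_inner_comm u y]
  simpa [sub_eq_zero] using hxy

/-! ### Faces and exposed edges -/

open Classical in
/-- The points of `W` at which the linear functional `⟪ν, ·⟫` is maximal on `W`. -/
noncomputable def face (W : Finset E3) (ν : E3) : Finset E3 :=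
  W.filter fun w => ∀ x ∈ W, inner ℝ ν x ≤ inner ℝ ν w

theorem mem_face {W : Finset E3} {ν w : E3} :
    w ∈ face W ν ↔ w ∈ W ∧ ∀ x ∈ W, inner ℝ ν x ≤ inner ℝ ν w := by
  classical
  simp [face]

theorem inner_eq_of_mem_face {W : Finset E3} {ν x y : E3} (hx : x ∈ face W ν)
    (hy : y ∈ face W ν) : inner ℝ ν x = inner ℝ ν y :=
  le_antisymm ((mem_face.1 hy).2 _ (mem_face.1 hx).1) ((mem_face.1 hx).2 _ (mem_face.1 hy).1)

/-- The functional `⟪n, ·⟫` exposes the segment `ab` of the convex hull of `W`. -/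
def Exposes (W : Finset E3) (n a b : E3) : Prop :=
  inner ℝ n a = inner ℝ n b ∧ ∀ w ∈ W, w ≠ a → w ≠ b → inner ℝ n w < inner ℝ n a

theorem Exposes.symm {W : Finset E3} {n a b : E3} (h : Exposes W n a b) : Exposes W n b a :=
  ⟨h.1.symm, fun w hw hb ha => h.1 ▸ h.2 w hw ha hb⟩

/-- A vertex has at most two exposed edges in a face. -/
theorem false_of_three_edges_in_face {W : Finset E3} {ν v : E3} (hν : ν ≠ 0)
    (hv : v ∈ face W ν) {x n : Fin 3 → E3} (hx : ∀ i, x i ∈ face W ν) (hxv : ∀ i, x i ≠ v)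
    (hinj : ∀ i j, i ≠ j → x i ≠ x j) (hn : ∀ i, Exposes W (n i) v (x i)) : False := by
  refine false_of_inner_neg_of_inner_eq_zero hν (d := fun i => x i - v) (f := n) ?_ ?_ ?_
  · intro i
    rw [inner_sub_right, inner_eq_of_mem_face (hx i) hv, sub_self]
  · intro i
    rw [inner_sub_right, (hn i).1, sub_self]
  · intro i j hij
    rw [inner_sub_right, sub_neg]
    exact (hn i).2 _ (mem_face.1 (hx j)).1 (hxv j) (hinj j i hij.symm)

/-- A point is an intermediate vertex, in the direction `u`, of at most two facets. -/
theorem false_of_three_facets {W : Finset E3} {r : ℝ} (hW : ∀ w ∈ W, ‖w‖ = r) {u v : E3}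
    {ν x y : Fin 3 → E3} (hν : ∀ i, ‖ν i‖ = 1) (hinj : ∀ i j, i ≠ j → ν i ≠ ν j)
    (hv : ∀ i, v ∈ face W (ν i)) (hx : ∀ i, x i ∈ face W (ν i)) (hy : ∀ i, y i ∈ face W (ν i))
    (hux : ∀ i, inner ℝ u v < inner ℝ u (x i)) (huy : ∀ i, inner ℝ u (y i) < inner ℝ u v) :
    False := by
  have mW : ∀ {i w}, w ∈ face W (ν i) → w ∈ W := fun h => (mem_face.1 h).1
  have par : ∀ i (μ : E3), ‖μ‖ = 1 → inner ℝ μ (x i) = inner ℝ μ v → inner ℝ μ (y i) = inner ℝ μ v →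
      μ = ν i ∨ μ = -ν i := by
    intro i μ hμ h1 h2
    refine eq_or_eq_neg_of_inner_const (hW _ (mW (hv i))) (hW _ (mW (hx i))) (hW _ (mW (hy i)))
      ?_ ?_ ?_ (hν i) hμ (inner_eq_of_mem_face (hx i) (hv i)) (inner_eq_of_mem_face (hy i) (hv i))
      h1 h2
    · intro h; have := hux i; rw [← h] at this; exact this.false
    · intro h; have := huy i; rw [← h] at this; exact this.false
    · intro h; have := hux i; rw [h] at this; exact (this.trans (huy i)).false
  -- The vector `d i` points from `v` along the facet `i` at constant height: it is the positive
  -- combination of an upward and a downward chord that is orthogonal to `u`. The plane argument is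
  -- thus applied to the horizontal section through `v`.
  refine false_of_inner_neg_of_inner_eq_zero (u := u) ?_ (f := ν) (d := fun i =>
    (inner ℝ u v - inner ℝ u (y i)) • (x i - v) + (inner ℝ u (x i) - inner ℝ u v) • (y i - v))
    ?_ ?_ ?_
  · rintro rfl
    simpa using hux 0
  · intro i
    simp only [inner_add_right, inner_smul_right, inner_sub_right]
    ring
  · intro i
    simp only [inner_add_right, inner_smul_right, inner_sub_right,
      inner_eq_of_mem_face (hx i) (hv i), inner_eq_of_mem_face (hy i) (hv i)]
    ring
  · intro i j hij
    have hxj := (mem_face.1 (hv i)).2 _ (mW (hx j))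
    have hyj := (mem_face.1 (hv i)).2 _ (mW (hy j))
    have hA := sub_pos.2 (huy j)
    have hB := sub_pos.2 (hux j)
    -- Otherwise `ν i = -ν j`, since the normals are distinct. Then `W` is flat, and the third
    -- normal must coincide with one of these two.
    have hne : ¬ (inner ℝ (ν i) (x j) = inner ℝ (ν i) v ∧ inner ℝ (ν i) (y j) = inner ℝ (ν i) v) := by
      rintro ⟨h1, h2⟩
      have hneg : ν i = -ν j := (par j (ν i) (hν i) h1 h2).resolve_left (hinj i j hij)
      have hconst : ∀ w ∈ W, inner ℝ (ν i) w = inner ℝ (ν i) v := by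
        intro w hw
        refine le_antisymm ((mem_face.1 (hv i)).2 _ hw) ?_
        have := (mem_face.1 (hv j)).2 _ hw
        rw [hneg, inner_neg_left, inner_neg_left]
        linarith
      obtain ⟨k, hki, hkj⟩ : ∃ k : Fin 3, k ≠ i ∧ k ≠ j := by
        clear * - 
        revert i j; decide
      rcases par k (ν i) (hν i) (hconst _ (mW (hx k))) (hconst _ (mW (hy k))) with h | h
      · exact hinj _ _ hki h.symm
      · exact hinj _ _ hkj (neg_injective (h.symm.trans hneg))
    simp only [inner_add_right, inner_smul_right, inner_sub_right]
    rcases lt_or_eq_of_le hxj with h | h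
    · nlinarith [mul_pos hA (sub_pos.2 h), mul_nonneg hB.le (sub_nonneg.2 hyj)]
    · have h' := lt_of_le_of_ne hyj (fun h' => hne ⟨h, h'⟩)
      nlinarith [mul_nonneg hA.le (sub_nonneg.2 hxj), mul_pos hB (sub_pos.2 h')]

/-- An exposed edge of a centrally symmetric subset of a sphere lies in a facet on the side of it
to which `t` points. -/
theorem exists_facet_of_edge {W : Finset E3} (hsymm : ∀ w ∈ W, -w ∈ W) (hcard : 3 ≤ W.card)
    {a b t n : E3} (ha : a ∈ W) (hb : b ∈ W) (hab : a ≠ b) (ht : t ≠ 0) (hta : inner ℝ t a = 0)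
    (htb : inner ℝ t b = 0) (htn : inner ℝ t n = 0) (hn : Exposes W n a b) :
    ∃ ν : E3, ‖ν‖ = 1 ∧ 0 < inner ℝ t ν ∧ a ∈ face W ν ∧ b ∈ face W ν ∧
      3 ≤ (face W ν).card := by
  classical
  suffices h : ∃ m : E3, 0 < inner ℝ t m ∧ a ∈ face W m ∧ b ∈ face W m ∧
      3 ≤ (face W m).card by
    obtain ⟨m, hm, ham, hbm, hc⟩ := h
    have hm0 : 0 < ‖m‖ := norm_pos_iff.2 (by rintro rfl; simp at hm)
    have hface : face W (‖m‖⁻¹ • m) = face W m := by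
      ext w
      simp only [mem_face, inner_smul_left, RCLike.conj_to_real]
      simp [hm0]
    refine ⟨‖m‖⁻¹ • m, ?_, ?_, ?_⟩
    · rw [norm_smul, norm_inv, norm_norm, inv_mul_cancel₀ hm0.ne']
    · rw [inner_smul_right]; positivity
    · rw [hface]; exact ⟨ham, hbm, hc⟩
  have htt : 0 < inner ℝ t t := by rwa [real_inner_self_pos]
  by_cases hex : ∃ w ∈ W, 0 < inner ℝ t w
  · obtain ⟨w₀, hw₀, hw₀t⟩ := hex
    -- Tilt `n` towards `t`. The values at `a` and `b` do not change, and the least ratio is the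
    -- tilt at which a further point first reaches their level.
    obtain ⟨w₁, hw₁, hmin⟩ := (W.filter fun w => 0 < inner ℝ t w).exists_min_image
      (fun w => (inner ℝ n a - inner ℝ n w) / inner ℝ t w) ⟨w₀, by simp [hw₀, hw₀t]⟩
    simp only [mem_filter] at hw₁ hmin
    obtain ⟨hw₁, hw₁t⟩ := hw₁
    have hw₁a : w₁ ≠ a := by rintro rfl; exact hw₁t.ne' hta
    have hw₁b : w₁ ≠ b := by rintro rfl; exact hw₁t.ne' htb
    have hle : ∀ w ∈ W, inner ℝ n w ≤ inner ℝ n a := by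
      intro w hw
      by_cases h1 : w = a
      · rw [h1]
      by_cases h2 : w = b
      · rw [h2, hn.1]
      exact (hn.2 w hw h1 h2).le
    set θ := (inner ℝ n a - inner ℝ n w₁) / inner ℝ t w₁ with hθ
    have hθpos : 0 < θ := div_pos (sub_pos.2 (hn.2 _ hw₁ hw₁a hw₁b)) hw₁t
    have hcomp : ∀ w, inner ℝ (n + θ • t) w = inner ℝ n w + θ * inner ℝ t w := fun w => by
      simp [inner_add_left, inner_smul_left]
    have hsup : ∀ w ∈ W, inner ℝ (n + θ • t) w ≤ inner ℝ n a := by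
      intro w hw
      rw [hcomp]
      by_cases hwt : 0 < inner ℝ t w
      · have := hmin w ⟨hw, hwt⟩
        rw [le_div_iff₀ hwt] at this
        linarith
      · nlinarith [hle w hw]
    have hmem : ∀ w ∈ W, inner ℝ (n + θ • t) w = inner ℝ n a → w ∈ face W (n + θ • t) :=
      fun w hw h => mem_face.2 ⟨hw, fun x hx => h ▸ hsup x hx⟩
    have fa := hmem a ha (by rw [hcomp, hta]; ring)
    have fb := hmem b hb (by rw [hcomp, htb, hn.1]; ring)
    have fw := hmem w₁ hw₁ (by rw [hcomp, hθ]; field_simp; ring)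
    refine ⟨n + θ • t, ?_, fa, fb, ?_⟩
    · rw [inner_add_right, inner_smul_right, htn]; positivity
    · exact two_lt_card.2 ⟨a, fa, b, fb, w₁, fw, hab, hw₁a.symm, hw₁b.symm⟩
  -- By central symmetry all of `W` lies in the plane orthogonal to `t`, so `t` itself serves as
  -- normal and the face is all of `W`.
  · push Not at hex
    have hzero : ∀ w ∈ W, inner ℝ t w = 0 := fun w hw => by
      have h1 := hex w hw
      have h2 := hex _ (hsymm w hw)
      rw [inner_neg_right] at h2
      linarith
    have hface : face W t = W := by
      ext w
      simp only [mem_face, and_iff_left_iff_imp]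
      exact fun hw x hx => by rw [hzero w hw, hzero x hx]
    exact ⟨t, htt, by rwa [hface], by rwa [hface], by rwa [hface]⟩

open Classical in
/-- The points of a face that are neither highest nor lowest in the direction `u`. -/
noncomputable def middle (W : Finset E3) (u ν : E3) : Finset E3 :=
  (face W ν).filter fun v => (∃ x ∈ face W ν, inner ℝ u v < inner ℝ u x) ∧
    ∃ y ∈ face W ν, inner ℝ u y < inner ℝ u v

theorem card_face_le_card_middle_add_two {W : Finset E3} {u : E3}
    (hu : Set.InjOn (fun x => inner ℝ u x) (W : Set E3)) (ν : E3) :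
    (face W ν).card ≤ (middle W u ν).card + 2 := by
  classical
  rcases (face W ν).eq_empty_or_nonempty with h | h
  · simp [h]
  obtain ⟨x, hx, hxmax⟩ := (face W ν).exists_max_image (fun w => inner ℝ u w) h
  obtain ⟨y, hy, hymin⟩ := (face W ν).exists_min_image (fun w => inner ℝ u w) h
  have hsub : face W ν ⊆ middle W u ν ∪ {x, y} := by
    intro v hv
    by_cases hvx : v = x
    · simp [hvx]
    by_cases hvy : v = y
    · simp [hvy]
    refine mem_union_left _ (mem_filter.2 ⟨hv, ⟨x, hx, ?_⟩, y, hy, ?_⟩)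
    · exact lt_of_le_of_ne (hxmax v hv) fun h => hvx (hu (mem_face.1 hv).1 (mem_face.1 hx).1 h)
    · exact lt_of_le_of_ne (hymin v hv) fun h => hvy (hu (mem_face.1 hv).1 (mem_face.1 hy).1 h.symm)
  calc (face W ν).card ≤ (middle W u ν ∪ {x, y}).card := card_le_card hsub
    _ ≤ (middle W u ν).card + ({x, y} : Finset E3).card := card_union_le _ _
    _ ≤ _ := by gcongr; exact card_le_two

theorem card_le_two_of_edges_in_face {W : Finset E3} {ν v : E3} (hν : ν ≠ 0)
    (hv : v ∈ face W ν) {S : Finset E3}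
    (hS : ∀ x ∈ S, x ∈ face W ν ∧ x ≠ v ∧ ∃ n, Exposes W n v x) : S.card ≤ 2 := by
  by_contra! h
  obtain ⟨x₀, h₀, x₁, h₁, x₂, h₂, h₀₁, h₀₂, h₁₂⟩ := two_lt_card.1 h
  have hx : ∀ i, (![x₀, x₁, x₂] : Fin 3 → E3) i ∈ S := by
    intro i; fin_cases i <;> simpa
  choose n hn using fun i => (hS _ (hx i)).2.2
  refine false_of_three_edges_in_face hν hv (fun i => (hS _ (hx i)).1)
    (fun i => (hS _ (hx i)).2.1) ?_ hn
  intro i j hij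
  fin_cases i <;> fin_cases j <;> simp_all [eq_comm]

/-! ### Counting edges through facets -/

/-- A bipartite graph of exposed edges has at most `2 (k - 2)` edges in a face with `k ≥ 3`
points. -/
theorem card_edges_in_face_le {A B : Finset E3} (hAB : Disjoint A B) {ν : E3} (hν : ν ≠ 0)
    {𝓔 : Finset (E3 × E3)} {W : Finset E3} (hW : ∀ w ∈ W, w ∈ A ∨ w ∈ B)
    (h𝓔 : ∀ e ∈ 𝓔, e.1 ∈ A ∧ e.2 ∈ B ∧ ∃ n, Exposes W n e.1 e.2)
    (hface : ∀ e ∈ 𝓔, e.1 ∈ face W ν ∧ e.2 ∈ face W ν) (hcard : 3 ≤ (face W ν).card) :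
    𝓔.card + 4 ≤ 2 * (face W ν).card := by
  classical
  have hne : ∀ e ∈ 𝓔, e.1 ≠ e.2 := fun e he h =>
    disjoint_left.1 hAB (h𝓔 e he).1 (h ▸ (h𝓔 e he).2.1)
  have hA : 𝓔.card ≤ 2 * ((face W ν).filter (· ∈ A)).card := by
    refine card_le_mul_card_image_of_maps_to (f := Prod.fst)
      (fun e he => mem_filter.2 ⟨(hface e he).1, (h𝓔 e he).1⟩) 2 fun v hv => ?_
    rw [← card_image_of_injOn (f := Prod.snd)]
    · refine card_le_two_of_edges_in_face hν (mem_filter.1 hv).1 ?_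
      simp only [mem_image, mem_filter]
      rintro _ ⟨e, ⟨he, rfl⟩, rfl⟩
      exact ⟨(hface e he).2, (hne e he).symm, (h𝓔 e he).2.2⟩
    · intro e he e' he' h
      simp only [coe_filter, Set.mem_ofPred_eq] at he he'
      exact Prod.ext (he.2.trans he'.2.symm) h
  have hB : 𝓔.card ≤ 2 * ((face W ν).filter (· ∈ B)).card := by
    refine card_le_mul_card_image_of_maps_to (f := Prod.snd)
      (fun e he => mem_filter.2 ⟨(hface e he).2, (h𝓔 e he).2.1⟩) 2 fun v hv => ?_
    rw [← card_image_of_injOn (f := Prod.fst)]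
    · refine card_le_two_of_edges_in_face hν (mem_filter.1 hv).1 ?_
      simp only [mem_image, mem_filter]
      rintro _ ⟨e, ⟨he, rfl⟩, rfl⟩
      exact ⟨(hface e he).1, hne e he, (h𝓔 e he).2.2.imp fun n hn => hn.symm⟩
    · intro e he e' he' h
      simp only [coe_filter, Set.mem_ofPred_eq] at he he'
      exact Prod.ext h (he.2.trans he'.2.symm)
  -- With a and b points in the two classes there are at most 2 min(a, b) edges. Since a + b ≥ 3,
  -- the larger class has at least two points, which gives 2(a + b) - 4.
  have hsum : ((face W ν).filter (· ∈ A)).card + ((face W ν).filter (· ∈ B)).card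
      = (face W ν).card := by
    rw [← card_union_of_disjoint, ← filter_or, filter_true_of_mem]
    · exact fun w hw => hW w (mem_face.1 hw).1
    · exact disjoint_filter.2 fun w _ hwA => disjoint_left.1 hAB hwA
  omega

theorem card_filter_mem_middle_le_two {W : Finset E3} {r : ℝ} (hW : ∀ w ∈ W, ‖w‖ = r) {u v : E3}
    {Φ : Finset E3} (hΦ : ∀ ν ∈ Φ, ‖ν‖ = 1 ∧ v ∈ middle W u ν) : Φ.card ≤ 2 := by
  classical
  by_contra! h
  obtain ⟨x₀, h₀, x₁, h₁, x₂, h₂, h₀₁, h₀₂, h₁₂⟩ := two_lt_card.1 h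
  have hx : ∀ i, (![x₀, x₁, x₂] : Fin 3 → E3) i ∈ Φ := by
    intro i; fin_cases i <;> simpa
  have hm := fun i => mem_filter.1 (hΦ _ (hx i)).2
  choose hv hxy using hm
  choose hx' hy' using hxy
  choose x hxf hxu using hx'
  choose y hyf hyu using hy'
  refine false_of_three_facets hW (fun i => (hΦ _ (hx i)).1) ?_ hv hxf hyf hxu hyu
  intro i j hij
  fin_cases i <;> fin_cases j <;> simp_all [eq_comm]

/-- The bound `2 |W| - 4` for bipartite graphs of exposed edges of a subset `W` of a sphere, each
of which lies in two facets. -/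
theorem card_bipartite_exposed_add_four_le {A B W : Finset E3} {r : ℝ} (hr : ∀ w ∈ W, ‖w‖ = r)
    (hAB : Disjoint A B) (hW : ∀ w ∈ W, w ∈ A ∨ w ∈ B) (hcard : 2 ≤ W.card)
    {𝓔 : Finset (E3 × E3)}
    (h𝓔 : ∀ e ∈ 𝓔, e.1 ∈ A ∧ e.2 ∈ B ∧ ∃ n, Exposes W n e.1 e.2)
    (hfacet : ∀ e ∈ 𝓔, ∃ ν ν' : E3, ν ≠ ν' ∧ ∀ μ, μ = ν ∨ μ = ν' →
      ‖μ‖ = 1 ∧ e.1 ∈ face W μ ∧ e.2 ∈ face W μ ∧ 3 ≤ (face W μ).card) :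
    𝓔.card + 4 ≤ 2 * W.card := by
  classical
  obtain ⟨u, hu⟩ := exists_inner_injOn W
  choose! ν₁ ν₂ hne hν using hfacet
  set Φ : Finset E3 := 𝓔.image ν₁ ∪ 𝓔.image ν₂ with hΦ
  have hΦ' : ∀ μ ∈ Φ, ‖μ‖ = 1 ∧ 3 ≤ (face W μ).card := by
    intro μ hμ
    simp only [hΦ, mem_union, mem_image] at hμ
    rcases hμ with ⟨e, he, rfl⟩ | ⟨e, he, rfl⟩
    · exact ⟨(hν e he _ (.inl rfl)).1, (hν e he _ (.inl rfl)).2.2.2⟩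
    · exact ⟨(hν e he _ (.inr rfl)).1, (hν e he _ (.inr rfl)).2.2.2⟩
  -- Incidences of edges with facets are counted from both sides; `Φ` holds only the normals chosen
  -- for the edges.
  have h1 : 𝓔.card * 2 ≤ ∑ e ∈ 𝓔, (Φ.filter fun μ => e.1 ∈ face W μ ∧ e.2 ∈ face W μ).card := by
    rw [← smul_eq_mul]
    refine card_nsmul_le_sum _ _ _ fun e he => ?_
    rw [← card_pair (hne e he)]
    refine card_le_card fun μ hμ => ?_
    have hμ' : μ = ν₁ e ∨ μ = ν₂ e := by simpa using hμ
    refine mem_filter.2 ⟨?_, (hν e he μ hμ').2.1, (hν e he μ hμ').2.2.1⟩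
    rcases hμ' with rfl | rfl
    · exact mem_union_left _ (mem_image_of_mem _ he)
    · exact mem_union_right _ (mem_image_of_mem _ he)
  have h2 : ∑ e ∈ 𝓔, (Φ.filter fun μ => e.1 ∈ face W μ ∧ e.2 ∈ face W μ).card
      = ∑ μ ∈ Φ, (𝓔.filter fun e => e.1 ∈ face W μ ∧ e.2 ∈ face W μ).card :=
    sum_card_bipartiteAbove_eq_sum_card_bipartiteBelow
      (fun (e : E3 × E3) μ => e.1 ∈ face W μ ∧ e.2 ∈ face W μ)
  have h3 : ∑ μ ∈ Φ, (𝓔.filter fun e => e.1 ∈ face W μ ∧ e.2 ∈ face W μ).card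
      ≤ ∑ μ ∈ Φ, 2 * (middle W u μ).card := by
    refine sum_le_sum fun μ hμ => ?_
    have := card_edges_in_face_le hAB (norm_ne_zero_iff.1 (by rw [(hΦ' μ hμ).1]; exact one_ne_zero))
      hW (𝓔 := 𝓔.filter fun e => e.1 ∈ face W μ ∧ e.2 ∈ face W μ)
      (fun e he => h𝓔 e (mem_filter.1 he).1) (fun e he => (mem_filter.1 he).2) (hΦ' μ hμ).2
    have := card_face_le_card_middle_add_two hu μ
    omega
  obtain ⟨x, hx, hxmax⟩ := W.exists_max_image (fun w => inner ℝ u w) (card_pos.1 (by omega))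
  obtain ⟨y, hy, hymin⟩ := W.exists_min_image (fun w => inner ℝ u w) (card_pos.1 (by omega))
  have hxy : x ≠ y := by
    rintro rfl
    obtain ⟨a, ha, b, hb, hab⟩ := one_lt_card.1 hcard
    refine hab (hu ha hb ?_)
    have := hxmax a ha; have := hxmax b hb; have := hymin a ha; have := hymin b hb
    change inner ℝ u a = inner ℝ u b
    linarith
  -- The highest and the lowest point of all of `W` are intermediate in no facet; this saves the
  -- constant 4.
  have h4 : ∑ μ ∈ Φ, (middle W u μ).card
      = ∑ v ∈ W \ {x, y}, (Φ.filter fun μ => v ∈ middle W u μ).card := by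
    refine Eq.trans ?_ (sum_card_bipartiteAbove_eq_sum_card_bipartiteBelow
      fun μ v => v ∈ middle W u μ)
    refine sum_congr rfl fun μ _ => congrArg card ?_
    ext v
    simp only [mem_bipartiteAbove, mem_sdiff, mem_insert, mem_singleton]
    refine ⟨fun hv => ⟨⟨?_, ?_⟩, hv⟩, fun hv => hv.2⟩
    · exact (mem_face.1 (mem_filter.1 hv).1).1
    · obtain ⟨-, ⟨a, ha, hav⟩, b, hb, hbv⟩ := mem_filter.1 hv
      rintro (rfl | rfl)
      · exact (hxmax a (mem_face.1 ha).1).not_gt hav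
      · exact (hymin b (mem_face.1 hb).1).not_gt hbv
  have h5 : ∑ v ∈ W \ {x, y}, (Φ.filter fun μ => v ∈ middle W u μ).card ≤ (W \ {x, y}).card * 2 := by
    rw [← smul_eq_mul]
    refine sum_le_card_nsmul _ _ _ fun v _ => ?_
    exact card_filter_mem_middle_le_two hr fun μ hμ =>
      ⟨(hΦ' μ (mem_filter.1 hμ).1).1, (mem_filter.1 hμ).2⟩
  have h6 : (W \ {x, y}).card + 2 = W.card := by
    rw [← card_pair hxy]
    exact card_sdiff_add_card_eq_card (by simp [insert_subset_iff, hx, hy])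
  rw [← mul_sum] at h3
  omega

/-! ### Strict pairs on a sphere and their number -/

section

variable {E : Type*} [NormedAddCommGroup E] [InnerProductSpace ℝ E]

/-- The planes through `p` and `q` are equidistant from `c`, so the two strip inequalities combine
into one absolute value. The condition does not change when `z` is replaced by its antipode, which
is why `V` may be symmetrised. -/
theorem isStrictDoubleNormalPair_iff_of_sphere {V : Set E} {c : E} {r : ℝ}
    (hV : V ⊆ Metric.sphere c r) {p q : E} :
    IsStrictDoubleNormalPair V p q ↔ p ∈ V ∧ q ∈ V ∧ p ≠ q ∧ ∀ z ∈ V, z ≠ p → z ≠ q →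
      |inner ℝ (z - c) (p - c) - inner ℝ (z - c) (q - c)| < r ^ 2 - inner ℝ (p - c) (q - c) := by
  have hself : ∀ x ∈ V, inner ℝ (x - c) (x - c) = r ^ 2 := by
    intro x hx
    rw [real_inner_self_eq_norm_sq, ← dist_eq_norm, hV hx]
  have h1 : ∀ p ∈ V, ∀ q z : E, inner ℝ (z - p) (q - p) = r ^ 2 - inner ℝ (p - c) (q - c)
      - (inner ℝ (z - c) (p - c) - inner ℝ (z - c) (q - c)) := by
    intro p hp q z
    rw [← hself p hp, ← sub_sub_sub_cancel_right z p c, ← sub_sub_sub_cancel_right q p c]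
    simp only [inner_sub_left (z - c) (p - c), inner_sub_right _ (q - c) (p - c)]
    ring
  have h2 : ∀ q ∈ V, ∀ p z : E, inner ℝ (z - q) (p - q) = r ^ 2 - inner ℝ (p - c) (q - c)
      + (inner ℝ (z - c) (p - c) - inner ℝ (z - c) (q - c)) := by
    intro q hq p z
    rw [h1 q hq p z, real_inner_comm (p - c) (q - c)]
    ring
  constructor
  · rintro ⟨⟨hp, hq, hne, hsub⟩, hdisj⟩
    refine ⟨hp, hq, hne, fun z hz hzp hzq => ?_⟩
    have hn := Set.disjoint_left.1 hdisj (show z ∈ V \ {p, q} from ⟨hz, by simp [hzp, hzq]⟩)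
    simp only [Set.mem_union, not_or, normalHyperplane, Set.mem_ofPred_eq] at hn
    have h3 := lt_of_le_of_ne (hsub hz).1 (Ne.symm hn.1)
    have h4 := lt_of_le_of_ne (hsub hz).2 (Ne.symm hn.2)
    rw [h1 p hp] at h3
    rw [h2 q hq] at h4
    rw [abs_lt]
    constructor <;> linarith
  · rintro ⟨hp, hq, hne, h⟩
    have h3 : ∀ z ∈ V, z ≠ p → z ≠ q →
        0 < inner ℝ (z - p) (q - p) ∧ 0 < inner ℝ (z - q) (p - q) := by
      intro z hz hzp hzq
      have := abs_lt.1 (h z hz hzp hzq)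
      rw [h1 p hp, h2 q hq]
      constructor <;> linarith
    refine ⟨⟨hp, hq, hne, fun z hz => ?_⟩, Set.disjoint_left.2 fun z hz hz' => ?_⟩
    · by_cases hzp : z = p
      · subst hzp
        simp [closedStrip]
      by_cases hzq : z = q
      · subst hzq
        simp [closedStrip]
      exact ⟨(h3 z hz hzp hzq).1.le, (h3 z hz hzp hzq).2.le⟩
    · obtain ⟨hzV, hz⟩ := hz
      simp only [Set.mem_insert_iff, Set.mem_singleton_iff, not_or] at hz
      rcases hz' with hz' | hz'
      · exact (h3 z hzV hz.1 hz.2).1.ne' hz'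
      · exact (h3 z hzV hz.1 hz.2).2.ne' hz'

theorem strictDoubleNormalCount_range {ι : Type*} {f : ι → E} (hf : Function.Injective f) :
    strictDoubleNormalCount (Set.range f)
      = (((strictDoubleNormalGraph (Set.range f)).comap (Equiv.ofInjective f hf))).edgeSet.ncard := by
  rw [strictDoubleNormalCount, ← Nat.card_coe_set_eq, ← Nat.card_coe_set_eq]
  exact Nat.card_congr (SimpleGraph.Iso.comap (Equiv.ofInjective f hf) _).mapEdgeSet.symm

theorem mem_edgeSet_comap_ofInjective {ι : Type*} {f : ι → E} (hf : Function.Injective f)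
    (i j : ι) : s(i, j) ∈ ((strictDoubleNormalGraph (Set.range f)).comap
      (Equiv.ofInjective f hf)).edgeSet ↔ IsStrictDoubleNormalPair (Set.range f) (f i) (f j) :=
  Iff.rfl

-- Ordered pairs are the darts of the graph. They are the form needed for the bipartite double,
-- where (p, q) and (q, p) give different edges.
open Classical in
theorem two_mul_strictDoubleNormalCount (V : Finset E) :
    2 * strictDoubleNormalCount (V : Set E) =
      ((V ×ˢ V).filter fun e => IsStrictDoubleNormalPair (V : Set E) e.1 e.2).card := by
  have : Fintype (V : Set E) := inferInstanceAs (Fintype V)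
  rw [strictDoubleNormalCount, ← SimpleGraph.coe_edgeFinset, Set.ncard_coe_finset,
    ← SimpleGraph.dart_card_eq_twice_card_edges, ← Finset.card_univ]
  refine card_bij (fun d _ => ((d.fst : E), (d.snd : E))) ?_ ?_ ?_
  · intro d _
    exact mem_filter.2 ⟨mem_product.2 ⟨d.fst.2, d.snd.2⟩, d.adj⟩
  · intro d _ d' _ h
    simp only [Prod.mk.injEq] at h
    exact SimpleGraph.Dart.ext _ _ (Prod.ext (Subtype.ext h.1) (Subtype.ext h.2))
  · intro e he
    obtain ⟨he, hadj⟩ := mem_filter.1 he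
    obtain ⟨h1, h2⟩ := mem_product.1 he
    exact ⟨⟨(⟨e.1, h1⟩, ⟨e.2, h2⟩), hadj⟩, mem_univ _, rfl⟩

end

/-! ### The upper bound -/

open Classical in
/-- The bound for sets without antipodal points. -/
theorem card_strict_pairs_add_four_le {V : Finset E3} {c : E3} {r : ℝ}
    (hV : (V : Set E3) ⊆ Metric.sphere c r) (hanti : ∀ p ∈ V, ∀ q ∈ V, p - c ≠ c - q)
    (hcard : 2 ≤ V.card) :
    ((V ×ˢ V).filter fun e => IsStrictDoubleNormalPair (V : Set E3) e.1 e.2).card + 4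
      ≤ 4 * V.card := by
  set A : Finset E3 := V.image (· - c) with hA
  set B : Finset E3 := V.image (c - ·) with hB
  have hnorm : ∀ w ∈ A ∪ B, ‖w‖ = r := by
    intro w hw
    simp only [hA, hB, mem_union, mem_image] at hw
    rcases hw with ⟨p, hp, rfl⟩ | ⟨p, hp, rfl⟩
    · exact mem_sphere_iff_norm.1 (hV hp)
    · rw [norm_sub_rev]; exact mem_sphere_iff_norm.1 (hV hp)
  have hAB : Disjoint A B := by
    rw [disjoint_left]
    simp only [hA, hB, mem_image]
    rintro _ ⟨p, hp, rfl⟩ ⟨q, hq, h⟩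
    exact hanti p hp q hq h.symm
  have hcardW : (A ∪ B).card = 2 * V.card := by
    rw [card_union_of_disjoint hAB, hA, hB, card_image_of_injective _ sub_left_injective,
      card_image_of_injective _ sub_right_injective, two_mul]
  have hsymm : ∀ w ∈ A ∪ B, -w ∈ A ∪ B := by
    intro w hw
    simp only [hA, hB, mem_union, mem_image] at hw ⊢
    rcases hw with ⟨p, hp, rfl⟩ | ⟨p, hp, rfl⟩
    · exact .inr ⟨p, hp, by simp⟩
    · exact .inl ⟨p, hp, by simp⟩
  set D := (V ×ˢ V).filter fun e => IsStrictDoubleNormalPair (V : Set E3) e.1 e.2 with hD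
  set 𝓔 := D.image fun e => (e.1 - c, c - e.2) with h𝓔
  have hcard𝓔 : 𝓔.card = D.card := by
    refine card_image_of_injective _ fun e e' h => ?_
    simp only [Prod.mk.injEq, sub_left_inj, sub_right_inj] at h
    exact Prod.ext h.1 h.2
  -- The normal is `e.1 - e.2`, written as the sum of the two endpoints so that a vector orthogonal
  -- to both is also orthogonal to it.
  have hexp : ∀ e ∈ D, Exposes (A ∪ B) ((e.1 - c) + (c - e.2)) (e.1 - c) (c - e.2) := by
    intro e he
    obtain ⟨he, hadj⟩ := mem_filter.1 he
    obtain ⟨h1, h2⟩ := mem_product.1 he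
    obtain ⟨-, -, hne, hz⟩ := (isStrictDoubleNormalPair_iff_of_sphere hV).1 hadj
    have n1 : inner ℝ (e.1 - c) (e.1 - c) = r ^ 2 := by
      rw [real_inner_self_eq_norm_sq, mem_sphere_iff_norm.1 (hV h1)]
    have n2 : inner ℝ (e.2 - c) (e.2 - c) = r ^ 2 := by
      rw [real_inner_self_eq_norm_sq, mem_sphere_iff_norm.1 (hV h2)]
    have hc := real_inner_comm (e.1 - c) (e.2 - c)
    have hpos : 0 < r ^ 2 - inner ℝ (e.1 - c) (e.2 - c) := by
      have : 0 < inner ℝ (e.1 - e.2) (e.1 - e.2) := by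
        rw [real_inner_self_pos]
        exact sub_ne_zero.2 hne
      rw [← sub_sub_sub_cancel_right e.1 e.2 c] at this
      simp only [inner_sub_left _ (e.2 - c), inner_sub_right _ _ (e.2 - c), n1, n2, hc] at this
      linarith
    have key : ∀ w : E3, inner ℝ ((e.1 - c) + (c - e.2)) (w - c)
        = inner ℝ (w - c) (e.1 - c) - inner ℝ (w - c) (e.2 - c) := by
      intro w
      rw [← neg_sub e.2 c, inner_add_left, inner_neg_left, real_inner_comm, real_inner_comm (w - c)]
      ring
    have key' : ∀ w : E3, inner ℝ ((e.1 - c) + (c - e.2)) (c - w)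
        = -(inner ℝ (w - c) (e.1 - c) - inner ℝ (w - c) (e.2 - c)) := by
      intro w
      rw [← neg_sub w c, inner_neg_right, key]
    refine ⟨?_, fun w hw hwa hwb => ?_⟩
    · rw [key, key', n1, n2, hc]; ring
    · rw [key, n1]
      simp only [hA, hB, mem_union, mem_image] at hw
      rcases hw with ⟨p, hp, rfl⟩ | ⟨p, hp, rfl⟩
      · rw [key]
        have hp1 : p ≠ e.1 := by rintro rfl; exact hwa rfl
        by_cases hp2 : p = e.2
        · rw [hp2, n2, hc]; linarith
        · exact (abs_lt.1 (hz p hp hp1 hp2)).2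
      · rw [key']
        have hp2 : p ≠ e.2 := by rintro rfl; exact hwb rfl
        by_cases hp1 : p = e.1
        · rw [hp1, n1]; linarith
        · linarith [(abs_lt.1 (hz p hp hp1 hp2)).1]
  have hmem : ∀ e ∈ D, e.1 - c ∈ A ∧ c - e.2 ∈ B := by
    intro e he
    obtain ⟨h1, h2⟩ := mem_product.1 (mem_filter.1 he).1
    exact ⟨mem_image_of_mem _ h1, mem_image_of_mem _ h2⟩
  have := card_bipartite_exposed_add_four_le hnorm hAB (fun w hw => mem_union.1 hw)
    (by omega) (𝓔 := 𝓔) ?_ ?_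
  · omega
  · rw [h𝓔, forall_mem_image]
    exact fun e he => ⟨(hmem e he).1, (hmem e he).2, _, hexp e he⟩
  · rw [h𝓔, forall_mem_image]
    intro e he
    dsimp only
    obtain ⟨t, ht, hta, htb⟩ : ∃ t : E3, t ≠ 0 ∧ inner ℝ t (e.1 - c) = 0 ∧ inner ℝ t (c - e.2) = 0 := by
      have hlt : finrank ℝ (Submodule.span ℝ (({e.1 - c, c - e.2} : Finset E3) : Set E3)) < finrank ℝ E3 := by
        refine (finrank_span_finset_le_card _).trans_lt ?_
        rw [finrank_euclideanSpace_fin]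
        exact Nat.lt_succ_of_le card_le_two
      have hbot : (Submodule.span ℝ (({e.1 - c, c - e.2} : Finset E3) : Set E3))ᗮ ≠ ⊥ := by
        intro h
        rw [Submodule.orthogonal_eq_bot_iff] at h
        rw [h, finrank_top] at hlt
        exact hlt.false
      obtain ⟨t, ht, ht0⟩ := Submodule.exists_mem_ne_zero_of_ne_bot hbot
      rw [Submodule.mem_orthogonal'] at ht
      exact ⟨t, ht0, ht _ (Submodule.subset_span (by simp)), ht _ (Submodule.subset_span (by simp))⟩
    have hne : e.1 - c ≠ c - e.2 := by
      obtain ⟨h1, h2⟩ := mem_product.1 (mem_filter.1 he).1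
      exact hanti _ h1 _ h2
    have hnt : inner ℝ t ((e.1 - c) + (c - e.2)) = 0 := by rw [inner_add_right, hta, htb, add_zero]
    have ha := mem_union_left B (hmem e he).1
    have hb := mem_union_right A (hmem e he).2
    -- Tilting towards `t` and towards `-t` gives facets on both sides of the edge; the sign of the
    -- inner product with `t` tells them apart.
    obtain ⟨ν, h1, h2, h3⟩ := exists_facet_of_edge hsymm (by omega) ha hb hne ht hta htb hnt (hexp e he)
    obtain ⟨ν', h1', h2', h3'⟩ := exists_facet_of_edge hsymm (by omega) ha hb hne (neg_ne_zero.2 ht)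
      (by rw [inner_neg_left, hta, neg_zero]) (by rw [inner_neg_left, htb, neg_zero])
      (by rw [inner_neg_left, hnt, neg_zero]) (hexp e he)
    rw [inner_neg_left] at h2'
    refine ⟨ν, ν', by rintro rfl; linarith, ?_⟩
    rintro μ (rfl | rfl)
    · exact ⟨h1, h3⟩
    · exact ⟨h1', h3'⟩

/-- A set of `n ≥ 2` points of a sphere has at most `2 n - 2` strict double-normal pairs. -/
theorem strictDoubleNormalCount_le {V : Finset E3} {c : E3} {r : ℝ} (hr : 0 < r)
    (hV : (V : Set E3) ⊆ Metric.sphere c r) (hcard : 2 ≤ V.card) :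
    strictDoubleNormalCount (V : Set E3) ≤ 2 * V.card - 2 := by
  classical
  have h2 := two_mul_strictDoubleNormalCount V
  set V' := V.filter fun p => c - (p - c) ∉ V with hV'
  set S := V.filter fun p => c - (p - c) ∈ V with hS
  set D := (V ×ˢ V).filter fun e => IsStrictDoubleNormalPair (V : Set E3) e.1 e.2 with hD
  have hsplit : S.card + V'.card = V.card := card_filter_add_card_filter_not _
  -- Thales: `q` sees the diameter through `p` under a right angle, so the antipode of `p` lies on
  -- the plane through `q`.
  have hdeg : ∀ p q, IsStrictDoubleNormalPair (V : Set E3) p q → c - (p - c) ∈ V →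
      q = c - (p - c) := by
    intro p q h hp'
    obtain ⟨hp, hq, hne, hz⟩ := (isStrictDoubleNormalPair_iff_of_sphere hV).1 h
    by_contra hqp
    have hself : inner ℝ (p - c) (p - c) = r ^ 2 := by
      rw [real_inner_self_eq_norm_sq, mem_sphere_iff_norm.1 (hV hp)]
    have := hz _ hp' ?_ (Ne.symm hqp)
    · have e1 : c - (p - c) - c = -(p - c) := by abel
      rw [e1, inner_neg_left, inner_neg_left, hself] at this
      have := (abs_lt.1 this).1
      linarith
    · intro h
      have h0 : p - c = 0 := by
        have : (2 : ℝ) • (p - c) = 0 := by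
          rw [two_smul]
          nth_rewrite 1 [← h]
          abel
        simpa using this
      rw [h0, inner_zero_left] at hself
      exact (pow_pos hr 2).ne hself
  -- A point of `S` starts at most one ordered pair. The other pairs have both ends in `V'` and stay
  -- strict there, as fewer points have to be tested.
  have hcardD : D.card ≤ S.card +
      ((V' ×ˢ V').filter fun e => IsStrictDoubleNormalPair (V' : Set E3) e.1 e.2).card := by
    have hsub : D ⊆ S.image (fun p => (p, c - (p - c))) ∪
        (V' ×ˢ V').filter fun e => IsStrictDoubleNormalPair (V' : Set E3) e.1 e.2 := by
      rintro ⟨p, q⟩ he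
      obtain ⟨he, hadj⟩ := mem_filter.1 he
      obtain ⟨hp, hq⟩ := mem_product.1 he
      dsimp only at hp hq hadj
      by_cases hp' : c - (p - c) ∈ V
      · refine mem_union_left _ (mem_image.2 ⟨p, mem_filter.2 ⟨hp, hp'⟩, ?_⟩)
        rw [hdeg p q hadj hp']
      · have hq' : c - (q - c) ∉ V := by
          intro hq'
          have := hdeg q p hadj.swap hq'
          apply hp'
          rw [this]
          simpa using hq
        have mp : p ∈ V' := mem_filter.2 ⟨hp, hp'⟩
        have mq : q ∈ V' := mem_filter.2 ⟨hq, hq'⟩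
        refine mem_union_right _ (mem_filter.2 ⟨mem_product.2 ⟨mp, mq⟩, ?_⟩)
        have hsubV : (V' : Set E3) ⊆ V := coe_subset.2 (filter_subset _ _)
        rw [isStrictDoubleNormalPair_iff_of_sphere hV] at hadj
        rw [isStrictDoubleNormalPair_iff_of_sphere (hsubV.trans hV)]
        exact ⟨mp, mq, hadj.2.2.1, fun z hz => hadj.2.2.2 z (hsubV hz)⟩
    exact (card_le_card hsub).trans ((card_union_le _ _).trans (by gcongr; exact card_image_le))
  rcases lt_or_ge V'.card 2 with hlt | hge
  · have h0 : (V' ×ˢ V').filter (fun e => IsStrictDoubleNormalPair (V' : Set E3) e.1 e.2) = ∅ := by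
      refine filter_eq_empty_iff.2 ?_
      rintro ⟨p, q⟩ he h
      obtain ⟨hp, hq⟩ := mem_product.1 he
      exact h.1.2.2.1 (card_le_one.1 (by omega) p hp q hq)
    rw [h0, card_empty] at hcardD
    omega
  · have := card_strict_pairs_add_four_le (V := V') (c := c) (r := r)
      ((coe_subset.2 (filter_subset _ _)).trans hV) ?_ hge
    · omega
    · intro p hp q hq h
      refine (mem_filter.1 hp).2 ?_
      rw [h]
      simpa using (mem_filter.1 hq).1

/-! ### Gram matrices and the five-point example -/

section Gram

variable {E : Type*} [NormedAddCommGroup E] [InnerProductSpace ℝ E]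

/-- A family of points of a sphere, in terms of its normalised Gram matrix. -/
theorem strict_pairs_of_gram {ι : Type*} {f : ι → E} {c : E} {r : ℝ} (hr : 0 < r) {G : ι → ι → ℝ}
    (hG : ∀ i j, inner ℝ (f i - c) (f j - c) = r ^ 2 * G i j) (hone : ∀ i, G i i = 1)
    (hlt : ∀ i j, i ≠ j → G i j < 1) :
    Function.Injective f ∧ Set.range f ⊆ Metric.sphere c r ∧
      ∀ i j, i ≠ j → (IsStrictDoubleNormalPair (Set.range f) (f i) (f j) ↔
        ∀ k, k ≠ i → k ≠ j → |G k i - G k j| < 1 - G i j) := by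
  have hr2 : 0 < r ^ 2 := by positivity
  have hinj : Function.Injective f := by
    intro i j hij
    by_contra hne
    have h := hG i j
    rw [← hij, hG i i, hone] at h
    exact (hlt i j hne).ne' (mul_left_cancel₀ hr2.ne' h)
  have hsphere : Set.range f ⊆ Metric.sphere c r := by
    rintro _ ⟨i, rfl⟩
    rw [mem_sphere_iff_norm, ← sq_eq_sq₀ (norm_nonneg _) hr.le, ← real_inner_self_eq_norm_sq, hG,
      hone, mul_one]
  refine ⟨hinj, hsphere, fun i j hij => ?_⟩
  rw [isStrictDoubleNormalPair_iff_of_sphere hsphere]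
  have hiff : ∀ k, |inner ℝ (f k - c) (f i - c) - inner ℝ (f k - c) (f j - c)|
      < r ^ 2 - inner ℝ (f i - c) (f j - c) ↔ |G k i - G k j| < 1 - G i j := by
    intro k
    rw [hG, hG, hG, ← mul_sub, abs_mul, abs_of_pos hr2, ← mul_one_sub, mul_lt_mul_iff_right₀ hr2]
  simp only [Set.mem_range_self, true_and, Set.forall_mem_range, hiff, hinj.ne_iff, ne_eq, hij,
    not_false_eq_true]

theorem inner_frame {u v w : E} (h : Orthonormal ℝ ![u, v, w]) (a b d a' b' d' : ℝ) :
    inner ℝ (a • u + b • v + d • w) (a' • u + b' • v + d' • w) = a * a' + b * b' + d * d' := by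
  have h3 := orthonormal_iff_ite.1 h
  have huu : inner ℝ u u = 1 := by simpa using h3 0 0
  have hvv : inner ℝ v v = 1 := by simpa using h3 1 1
  have hww : inner ℝ w w = 1 := by simpa using h3 2 2
  have huv : inner ℝ u v = 0 := by simpa using h3 0 1
  have huw : inner ℝ u w = 0 := by simpa using h3 0 2
  have hvw : inner ℝ v w = 0 := by simpa using h3 1 2
  have hvu : inner ℝ v u = 0 := by simpa using h3 1 0
  have hwu : inner ℝ w u = 0 := by simpa using h3 2 0
  have hwv : inner ℝ w v = 0 := by simpa using h3 2 1
  simp only [inner_add_left, inner_add_right, inner_smul_left, inner_smul_right,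
    RCLike.conj_to_real, huu, hvv, hww, huv, huw, hvw, hvu, hwu, hwv]
  ring

end Gram

/-- Both sides are 2 sin((s + t)/2) times a sine, with arguments (t - s)/2 < (t + s)/2. -/
theorem cos_sub_cos_lt {s t : ℝ} (hs : 0 < s) (ht : 0 < t) (hst : s + t ≤ Real.pi) :
    Real.cos s - Real.cos t < 1 - Real.cos (s + t) := by
  have h1 : Real.cos s - Real.cos t = 2 * Real.sin ((s + t) / 2) * Real.sin ((t - s) / 2) := by
    rw [Real.cos_sub_cos, ← neg_sub t s, neg_div, Real.sin_neg]
    ring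
  have h2 : 1 - Real.cos (s + t) = 2 * Real.sin ((s + t) / 2) * Real.sin ((s + t) / 2) := by
    have := Real.cos_sq ((s + t) / 2)
    rw [mul_div_cancel₀ _ two_ne_zero] at this
    have := Real.sin_sq_add_cos_sq ((s + t) / 2)
    linarith
  have h3 : 0 < Real.sin ((s + t) / 2) := Real.sin_pos_of_pos_of_lt_pi (by linarith) (by linarith)
  rw [h1, h2]
  refine mul_lt_mul_of_pos_left (Real.sin_lt_sin_of_lt_of_le_pi_div_two ?_ ?_ ?_) (by linarith) <;>
    linarith

/-- Geometrically, an interior point of an arc of length at most π lies strictly inside the strip of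
its chord. -/
theorem abs_cos_sub_cos_lt {s t : ℝ} (hs : 0 < s) (ht : 0 < t) (hst : s + t ≤ Real.pi) :
    |Real.cos s - Real.cos t| < 1 - Real.cos (s + t) := by
  rw [abs_lt]
  have h1 := cos_sub_cos_lt hs ht hst
  have h2 := cos_sub_cos_lt ht hs (by linarith)
  rw [add_comm t s] at h2
  constructor <;> linarith

/-- Geometrically, the triangle of three points on an arc shorter than π has an obtuse angle at the
middle one. -/
theorem one_add_cos_add_lt {s t : ℝ} (hs : 0 < s) (ht : 0 < t) (hst : s + t < Real.pi) :
    1 + Real.cos (s + t) < Real.cos s + Real.cos t := by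
  have h1 := Real.cos_add_cos s t
  have h2 : 1 + Real.cos (s + t) = 2 * Real.cos ((s + t) / 2) * Real.cos ((s + t) / 2) := by
    have := Real.cos_sq ((s + t) / 2)
    rw [mul_div_cancel₀ _ two_ne_zero] at this
    linarith
  have h3 : 0 < Real.cos ((s + t) / 2) := Real.cos_pos_of_mem_Ioo ⟨by linarith, by linarith⟩
  rw [h1, h2]
  refine mul_lt_mul_of_pos_left ?_ (by linarith)
  rw [← Real.cos_abs ((s - t) / 2)]
  refine Real.cos_lt_cos_of_nonneg_of_le_pi_div_two (abs_nonneg _) (by linarith) ?_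
  rw [abs_lt]
  constructor <;> linarith

/-- The normalised Gram matrix of `fivePoints`. -/
noncomputable def fivePointsGram (s t : ℝ) : Fin 5 → Fin 5 → ℝ :=
  ![![1, -1 / 2, -1 / 2, -Real.cos s / 2, -Real.cos t / 2],
    ![-1 / 2, 1, -1 / 2, -Real.cos s / 2, -Real.cos t / 2],
    ![-1 / 2, -1 / 2, 1, Real.cos s, Real.cos t],
    ![-Real.cos s / 2, -Real.cos s / 2, Real.cos s, 1, Real.cos (s + t)],
    ![-Real.cos t / 2, -Real.cos t / 2, Real.cos t, Real.cos (s + t), 1]]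

theorem inner_fivePoints {E : Type*} [NormedAddCommGroup E] [InnerProductSpace ℝ E] (c : E) (r : ℝ)
    {u v w : E} (h : Orthonormal ℝ ![u, v, w]) (s t : ℝ) (i j : Fin 5) :
    inner ℝ (fivePoints c r u v w s t i - c) (fivePoints c r u v w s t j - c)
      = r ^ 2 * fivePointsGram s t i j := by
  have hcos : Real.cos (2 * Real.pi / 3) = -1 / 2 := by
    rw [show 2 * Real.pi / 3 = Real.pi - Real.pi / 3 by ring, Real.cos_pi_sub, Real.cos_pi_div_three]
    ring
  have hsin : Real.sin (2 * Real.pi / 3) = √3 / 2 := by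
    rw [show 2 * Real.pi / 3 = Real.pi - Real.pi / 3 by ring, Real.sin_pi_sub, Real.sin_pi_div_three]
  have h3 : √3 * √3 = 3 := Real.mul_self_sqrt (by norm_num)
  have hs := Real.sin_sq_add_cos_sq s
  have ht := Real.sin_sq_add_cos_sq t
  have hadd := Real.cos_add s t
  have hf : ∀ k, fivePoints c r u v w s t k - c = r •
      (![-1 / 2, -1 / 2, 1, Real.cos s, Real.cos t] k • u + ![√3 / 2, -(√3 / 2), 0, 0, 0] k • v
        + ![0, 0, 0, Real.sin s, -Real.sin t] k • w) := by
    intro k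
    fin_cases k <;> simp [fivePoints, hcos, hsin, sub_eq_add_neg]
  rw [hf, hf, inner_smul_left, inner_smul_right, inner_frame h, RCLike.conj_to_real, ← mul_assoc,
    ← sq]
  congr 1
  fin_cases i <;> fin_cases j <;> simp [fivePointsGram] <;> linarith

theorem fivePoints_spec {E : Type*} [NormedAddCommGroup E] [InnerProductSpace ℝ E] (c : E) {r : ℝ}
    (hr : 0 < r) {u v w : E} (h : Orthonormal ℝ ![u, v, w]) {s t : ℝ} (hs : 0 < s)
    (hs' : s < 1 / 2) (ht : 0 < t) (ht' : t < 1 / 2) :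
    Function.Injective (fivePoints c r u v w s t) ∧
    Set.range (fivePoints c r u v w s t) ⊆ Metric.sphere c r ∧
    (∀ i j : Fin 5, i ≠ j →
      (IsStrictDoubleNormalPair (Set.range (fivePoints c r u v w s t))
          (fivePoints c r u v w s t i) (fivePoints c r u v w s t j) ↔
        s(i, j) ≠ s(2, 3) ∧ s(i, j) ≠ s(2, 4))) ∧
    strictDoubleNormalCount (Set.range (fivePoints c r u v w s t)) = 8 := by
  have hpi := Real.pi_gt_three
  have hlt1 : ∀ x : ℝ, 0 < x → x < 1 → 0 < Real.cos x ∧ Real.cos x < 1 := fun x h0 h1 =>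
    ⟨Real.cos_pos_of_mem_Ioo ⟨by linarith, by linarith⟩, by
      have := Real.cos_lt_cos_of_nonneg_of_le_pi_div_two le_rfl (by linarith) h0
      rwa [Real.cos_zero] at this⟩
  obtain ⟨s0, s1⟩ := hlt1 s hs (by linarith)
  obtain ⟨t0, t1⟩ := hlt1 t ht (by linarith)
  -- The bound 1/2 on both angles keeps their sum below 1, where the cosine is positive.
  obtain ⟨st0, st1⟩ := hlt1 (s + t) (by linarith) (by linarith)
  obtain ⟨hd1, hd2⟩ := abs_lt.1 (abs_cos_sub_cos_lt hs ht (by linarith))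
  have hobt := one_add_cos_add_lt hs ht (by linarith)
  obtain ⟨hinj, hsphere, hiff⟩ := strict_pairs_of_gram (c := c) hr
    (inner_fivePoints c r h s t)
    (by intro i; fin_cases i <;> simp [fivePointsGram])
    (by
      intro i j hij
      fin_cases i <;> fin_cases j <;> first
        | exact absurd rfl hij
        | (simp [fivePointsGram]; linarith))
  have hpairs : ∀ i j : Fin 5, i ≠ j →
      (IsStrictDoubleNormalPair (Set.range (fivePoints c r u v w s t))
          (fivePoints c r u v w s t i) (fivePoints c r u v w s t j) ↔
        s(i, j) ≠ s(2, 3) ∧ s(i, j) ≠ s(2, 4)) := by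
    intro i j hij
    rw [hiff i j hij]
    constructor
    · intro hk
      by_contra hcon
      have hcases : ∀ i j : Fin 5, ¬(s(i, j) ≠ s(2, 3) ∧ s(i, j) ≠ s(2, 4)) →
          (i = 2 ∧ j = 3) ∨ (i = 3 ∧ j = 2) ∨ (i = 2 ∧ j = 4) ∨ (i = 4 ∧ j = 2) := by decide
      -- The remaining one of `p₄`, `p₅` violates the strip condition because of the obtuse angle at
      -- `p₃`.
      rcases hcases i j hcon with ⟨rfl, rfl⟩ | ⟨rfl, rfl⟩ | ⟨rfl, rfl⟩ | ⟨rfl, rfl⟩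
      · have := abs_lt.1 (hk 4 (by decide) (by decide))
        simp [fivePointsGram] at this
        linarith
      · have := abs_lt.1 (hk 4 (by decide) (by decide))
        simp [fivePointsGram] at this
        linarith
      · have := abs_lt.1 (hk 3 (by decide) (by decide))
        simp [fivePointsGram] at this
        linarith
      · have := abs_lt.1 (hk 3 (by decide) (by decide))
        simp [fivePointsGram] at this
        linarith
    · intro hne k hki hkj
      rw [abs_lt]
      fin_cases i <;> fin_cases j <;> first
        | exact absurd rfl hij
        | exact absurd hne (by decide)
        | (fin_cases k <;> first
            | exact absurd rfl hki
            | exact absurd rfl hkj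
            | (simp only [fivePointsGram]; constructor <;> simp <;> linarith))
  refine ⟨hinj, hsphere, hpairs, ?_⟩
  rw [strictDoubleNormalCount_range hinj]
  have hset : ((strictDoubleNormalGraph (Set.range (fivePoints c r u v w s t))).comap
      (Equiv.ofInjective _ hinj)).edgeSet =
      ((univ.filter fun e : Sym2 (Fin 5) => ¬ e.IsDiag ∧ e ≠ s(2, 3) ∧ e ≠ s(2, 4) :
        Finset (Sym2 (Fin 5))) : Set (Sym2 (Fin 5))) := by
    ext e
    induction e using Sym2.ind with
    | _ i j =>
      rw [mem_edgeSet_comap_ofInjective, coe_filter]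
      simp only [mem_univ, true_and, Set.mem_ofPred_eq, Sym2.mk_isDiag_iff]
      by_cases hij : i = j
      · subst hij
        simpa using fun h : IsStrictDoubleNormalPair _ _ _ => h.1.2.2.1 rfl
      · rw [hpairs i j hij]
        simp [hij]
  rw [hset, Set.ncard_coe_finset]
  decide

/-! ### Sharpness -/

/-- The points used for the sharpness of the bound: two nearly antipodal points and `m` points on
an arc of the great circle that bisects them. -/
noncomputable def arcConfiguration {E : Type*} [NormedAddCommGroup E] [InnerProductSpace ℝ E]
    (c : E) (r : ℝ) (u v w : E) (k : ℝ) (m : ℕ) : Fin 2 ⊕ Fin m → E :=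
  Sum.elim
    ![c + r • ((-k) • u + √(1 - k ^ 2) • v + (0 : ℝ) • w),
      c + r • ((-k) • u + (-√(1 - k ^ 2)) • v + (0 : ℝ) • w)]
    fun i => c + r • (Real.cos (i / m) • u + (0 : ℝ) • v + Real.sin (i / m) • w)

/-- The normalised Gram matrix of `arcConfiguration`. -/
noncomputable def arcGram (k : ℝ) (m : ℕ) : Fin 2 ⊕ Fin m → Fin 2 ⊕ Fin m → ℝ
  | .inl a, .inl b => if a = b then 1 else 2 * k ^ 2 - 1
  | .inl _, .inr i => -(k * Real.cos (i / m))
  | .inr i, .inl _ => -(k * Real.cos (i / m))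
  | .inr i, .inr j => Real.cos (i / m - j / m)

theorem inner_arcConfiguration {E : Type*} [NormedAddCommGroup E] [InnerProductSpace ℝ E] (c : E)
    (r : ℝ) {u v w : E} (h : Orthonormal ℝ ![u, v, w]) {k : ℝ} (hk : k ^ 2 ≤ 1) (m : ℕ)
    (x y : Fin 2 ⊕ Fin m) :
    inner ℝ (arcConfiguration c r u v w k m x - c) (arcConfiguration c r u v w k m y - c)
      = r ^ 2 * arcGram k m x y := by
  have hsq : √(1 - k ^ 2) * √(1 - k ^ 2) = 1 - k ^ 2 := Real.mul_self_sqrt (by linarith)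
  have hfr : ∀ a b d a' b' d' : ℝ, inner ℝ (r • (a • u + b • v + d • w))
      (r • (a' • u + b' • v + d' • w)) = r ^ 2 * (a * a' + b * b' + d * d') := by
    intro a b d a' b' d'
    rw [inner_smul_left, inner_smul_right, inner_frame h, RCLike.conj_to_real]
    ring
  rcases x with a | i <;> rcases y with b | j
  · fin_cases a <;> fin_cases b <;>
      simp only [arcConfiguration, arcGram, Sum.elim_inl, Fin.zero_eta, Fin.mk_one, Fin.isValue,
        Matrix.cons_val_zero, Matrix.cons_val_one, add_sub_cancel_left, hfr] <;>
      simp only [if_true, if_false, zero_ne_one, one_ne_zero] <;> congr 1 <;> linarith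
  · fin_cases a <;>
      simp only [arcConfiguration, arcGram, Sum.elim_inl, Sum.elim_inr, Fin.zero_eta, Fin.mk_one,
        Fin.isValue, Matrix.cons_val_zero, Matrix.cons_val_one, add_sub_cancel_left, hfr] <;> ring
  · fin_cases b <;>
      simp only [arcConfiguration, arcGram, Sum.elim_inl, Sum.elim_inr, Fin.zero_eta, Fin.mk_one,
        Fin.isValue, Matrix.cons_val_zero, Matrix.cons_val_one, add_sub_cancel_left, hfr] <;> ring
  · simp only [arcConfiguration, arcGram, Sum.elim_inr, add_sub_cancel_left, hfr, Real.cos_sub]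
    ring

/-- The strict double-normal pairs of `arcConfiguration`. -/
def arcEdge {m : ℕ} (first last : Fin m) : (Fin 2 × Fin m) ⊕ Bool → Sym2 (Fin 2 ⊕ Fin m)
  | .inl x => s(.inl x.1, .inr x.2)
  | .inr true => s(.inl 0, .inl 1)
  | .inr false => s(.inr first, .inr last)

theorem arcEdge_injective {m : ℕ} (first last : Fin m) :
    Function.Injective (arcEdge first last) := by
  rintro (⟨a, i⟩ | _ | _) (⟨b, j⟩ | _ | _) h <;> simp [arcEdge] at h ⊢
  exact h

theorem exists_sharp_configuration (c : E3) {r : ℝ} (hr : 0 < r) {m : ℕ} (hm : 2 ≤ m) :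
    ∃ f : Fin 2 ⊕ Fin m → E3, Function.Injective f ∧ Set.range f ⊆ Metric.sphere c r ∧
      2 * m + 2 ≤ strictDoubleNormalCount (Set.range f) := by
  have hpi := Real.pi_gt_three
  have hm0 : (0 : ℝ) < m := by positivity
  have hm1 : 1 / (m : ℝ) < 1 := by
    rw [div_lt_one hm0]
    exact_mod_cast hm
  -- The poles must not be antipodal (k > 0), or by Thales they would have no other partners. The
  -- value is the least 1 - cos of the angle between two arc points; any larger defect could spoil
  -- the bound `hsep`.
  set k := 1 - Real.cos (1 / m) with hk
  have hminv : 0 < 1 / (m : ℝ) := by positivity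
  have hk0 : 0 < k := by
    have := Real.cos_lt_cos_of_nonneg_of_le_pi_div_two le_rfl (by linarith) hminv
    rw [Real.cos_zero] at this
    linarith
  have hk1 : k < 1 := by
    have : 0 < Real.cos (1 / m) := Real.cos_pos_of_mem_Ioo ⟨by linarith, by linarith⟩
    linarith
  have hθ : ∀ i : Fin m, 0 ≤ (i : ℝ) / m ∧ (i : ℝ) / m < 1 := fun i =>
    ⟨by positivity, by rw [div_lt_one hm0]; exact_mod_cast i.2⟩
  have hcospos : ∀ x : ℝ, |x| ≤ 1 → 0 < Real.cos x := fun x hx => by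
    obtain ⟨h1, h2⟩ := abs_le.1 hx
    exact Real.cos_pos_of_mem_Ioo ⟨by linarith, by linarith⟩
  have hcos : ∀ i : Fin m, 0 < Real.cos (i / m) := fun i =>
    hcospos _ (by rw [abs_of_nonneg (hθ i).1]; exact (hθ i).2.le)
  have hdiff1 : ∀ i j : Fin m, |(i : ℝ) / m - j / m| ≤ 1 := fun i j => by
    have := hθ i
    have := hθ j
    rw [abs_le]
    constructor <;> linarith
  have hsep : ∀ i j : Fin m, i ≠ j → k ≤ 1 - Real.cos (i / m - j / m) := by
    intro i j hij
    have h1 : 1 / (m : ℝ) ≤ |(i : ℝ) / m - j / m| := by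
      rw [← sub_div, abs_div, abs_of_pos hm0]
      gcongr
      have : (1 : ℤ) ≤ |((i : ℕ) : ℤ) - (j : ℕ)| :=
        Int.one_le_abs (sub_ne_zero.2 fun h => hij (Fin.ext (by exact_mod_cast h)))
      exact_mod_cast this
    have := Real.cos_le_cos_of_nonneg_of_le_pi hminv.le (by linarith [hdiff1 i j]) h1
    rw [Real.cos_abs] at this
    linarith
  have hcomm : ∀ i j : Fin m, Real.cos (i / m - j / m) = Real.cos (j / m - i / m) := fun i j => by
    rw [← Real.cos_neg, neg_sub]
  have hcmp : ∀ i j : Fin m, i ≠ j →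
      k * Real.cos (j / m) - k * Real.cos (i / m) < 1 - Real.cos (i / m - j / m) := by
    intro i j hij
    have := hsep i j hij
    nlinarith [hcos i, Real.cos_le_one ((j : ℝ) / m)]
  have horth : Orthonormal ℝ ![EuclideanSpace.basisFun (Fin 3) ℝ 0,
      EuclideanSpace.basisFun (Fin 3) ℝ 1, EuclideanSpace.basisFun (Fin 3) ℝ 2] := by
    have hb := (EuclideanSpace.basisFun (Fin 3) ℝ).orthonormal
    rwa [show ⇑(EuclideanSpace.basisFun (Fin 3) ℝ) = ![EuclideanSpace.basisFun (Fin 3) ℝ 0,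
      EuclideanSpace.basisFun (Fin 3) ℝ 1, EuclideanSpace.basisFun (Fin 3) ℝ 2] from
      funext fun i => by fin_cases i <;> rfl] at hb
  have hksq : k ^ 2 < 1 := by nlinarith
  obtain ⟨hinj, hsphere, hiff⟩ := strict_pairs_of_gram (c := c) hr
    (inner_arcConfiguration c r horth hksq.le m)
    (by rintro (a | i) <;> simp [arcGram])
    (by
      rintro (a | i) (b | j) hij
      · have : a ≠ b := fun h => hij (congrArg _ h)
        simp only [arcGram, this, if_false]
        linarith
      · have := mul_pos hk0 (hcos j)
        simp only [arcGram]
        linarith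
      · have := mul_pos hk0 (hcos i)
        simp only [arcGram]
        linarith
      · have := hsep i j fun h => hij (congrArg _ h)
        simp only [arcGram]
        linarith)
  refine ⟨_, hinj, hsphere, ?_⟩
  set f := arcConfiguration c r _ _ _ k m
  have hpoles : IsStrictDoubleNormalPair (Set.range f) (f (.inl 0)) (f (.inl 1)) := by
    rw [hiff _ _ (by simp)]
    rintro (a | i) h0 h1
    · exfalso
      fin_cases a
      · exact h0 rfl
      · exact h1 rfl
    · simp [arcGram]
      linarith
  have hspokes : ∀ (a : Fin 2) (i : Fin m),
      IsStrictDoubleNormalPair (Set.range f) (f (.inl a)) (f (.inr i)) := by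
    intro a i
    rw [hiff _ _ (by simp)]
    have hki := mul_pos hk0 (hcos i)
    rintro (b | j) h0 h1 <;> rw [abs_lt]
    · have : b ≠ a := fun h => h0 (congrArg _ h)
      simp only [arcGram, this, if_false]
      constructor <;> nlinarith
    · have hji : j ≠ i := fun h => h1 (congrArg _ h)
      have h2 := hcmp i j hji.symm
      have h3 := hcospos _ (hdiff1 j i)
      have h4 := mul_pos hk0 (hcos j)
      rw [hcomm] at h2
      simp only [arcGram]
      constructor <;> linarith
  set first : Fin m := ⟨0, by omega⟩ with hfirst
  set last : Fin m := ⟨m - 1, by omega⟩ with hlast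
  have hfl : first ≠ last := by
    simp only [hfirst, hlast, ne_eq, Fin.mk.injEq]
    omega
  have hends : IsStrictDoubleNormalPair (Set.range f) (f (.inr first)) (f (.inr last)) := by
    rw [hiff _ _ (by simpa using hfl)]
    rintro (b | j) h0 h1
    · have h2 := hcmp first last hfl
      have h3 := hcmp last first hfl.symm
      rw [hcomm] at h3
      rw [abs_lt]
      simp only [arcGram]
      constructor <;> linarith
    · have h2 : first < j := lt_of_le_of_ne (Fin.mk_le_of_le_val (Nat.zero_le _))
        fun h => h0 (congrArg _ h.symm)
      have h3 : j < last := lt_of_le_of_ne (Fin.le_def.2 (by simp [hlast]; omega))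
        fun h => h1 (congrArg _ h)
      have h2' : (first : ℝ) / m < j / m := by
        gcongr
        exact_mod_cast h2
      have h3' : (j : ℝ) / m < last / m := by
        gcongr
        exact_mod_cast h3
      have h4 := abs_cos_sub_cos_lt (sub_pos.2 h2') (sub_pos.2 h3')
        (by linarith [(abs_le.1 (hdiff1 last first)).2])
      simp only [arcGram]
      rw [hcomm j last, hcomm first last]
      convert h4 using 3
      ring
  -- A lower bound suffices, since the general upper bound excludes further pairs: 2m spokes, the
  -- pair of poles and the pair of ends.
  rw [strictDoubleNormalCount_range hinj, ← Nat.card_coe_set_eq]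
  have hmem : ∀ x, arcEdge first last x ∈ ((strictDoubleNormalGraph (Set.range f)).comap
      (Equiv.ofInjective f hinj)).edgeSet := by
    rintro (⟨a, i⟩ | _ | _)
    exacts [hspokes a i, hends, hpoles]
  have := Nat.card_le_card_of_injective _ ((arcEdge_injective first last).codRestrict hmem)
  simpa [mul_comm] using this

theorem theorem2 (c : EuclideanSpace ℝ (Fin 3)) (r : ℝ) (hr : 0 < r) :
    (∀ V : Set (EuclideanSpace ℝ (Fin 3)), V.Finite → V ⊆ Metric.sphere c r → 4 ≤ V.ncard →
      strictDoubleNormalCount V ≤ 2 * V.ncard - 2) ∧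
    (∀ n : ℕ, 4 ≤ n → ∃ V : Set (EuclideanSpace ℝ (Fin 3)),
      V.Finite ∧ V ⊆ Metric.sphere c r ∧ V.ncard = n ∧
        strictDoubleNormalCount V = 2 * n - 2) ∧
    (∃ ε : ℝ, 0 < ε ∧ ∀ u v w : EuclideanSpace ℝ (Fin 3), Orthonormal ℝ ![u, v, w] →
      ∀ s t : ℝ, 0 < s → s < ε → 0 < t → t < ε →
        Function.Injective (fivePoints c r u v w s t) ∧
        Set.range (fivePoints c r u v w s t) ⊆ Metric.sphere c r ∧
        (∀ i j : Fin 5, i ≠ j →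
          (IsStrictDoubleNormalPair (Set.range (fivePoints c r u v w s t))
              (fivePoints c r u v w s t i) (fivePoints c r u v w s t j) ↔
            s(i, j) ≠ s(2, 3) ∧ s(i, j) ≠ s(2, 4))) ∧
        strictDoubleNormalCount (Set.range (fivePoints c r u v w s t)) = 8) := by
  have upper : ∀ V : Set (EuclideanSpace ℝ (Fin 3)), V.Finite → V ⊆ Metric.sphere c r →
      4 ≤ V.ncard → strictDoubleNormalCount V ≤ 2 * V.ncard - 2 := by
    intro V hfin hV hcard
    lift V to Finset (EuclideanSpace ℝ (Fin 3)) using hfin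
    rw [Set.ncard_coe_finset] at hcard ⊢
    exact strictDoubleNormalCount_le hr hV (by omega)
  refine ⟨upper, fun n hn => ?_, 1 / 2, by norm_num, fun u v w h s t hs hs' ht ht' =>
    fivePoints_spec c hr h hs hs' ht ht'⟩
  obtain ⟨f, hinj, hsphere, hle⟩ := exists_sharp_configuration c hr (m := n - 2) (by omega)
  have hcard : (Set.range f).ncard = n := by
    rw [← Nat.card_coe_set_eq, Nat.card_range_of_injective hinj, Nat.card_eq_fintype_card,
      Fintype.card_sum, Fintype.card_fin, Fintype.card_fin]
    omega
  refine ⟨Set.range f, Set.finite_range f, hsphere, hcard, le_antisymm ?_ (by omega)⟩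
  have := upper _ (Set.finite_range f) hsphere (by omega)
  rwa [hcard] at this
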